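/- Let $d \ge 1$, let $C=\{c^1,\dots,c^k\}\subset\mathbb{R}^d$ be a set of $k\ge 1$ (distinct) reference centers, and let $M=\max_{i,j}|c^i_j|$. The \textsc{RandomCoordinateCut} algorithm starts with a tree consisting of a single root to which all centers are assigned. As long as some leaf has at least two distinct centers assigned to it, it draws, independently of the past, a coordinate $j\in\{1,\dots,d\}$ uniformly at random and, independently of $j$, a threshold $\theta$ uniformly at random from $(-M,M)$. It then splits every leaf $u$, with assigned set $C_u$, for which both $\{c\in C_u: c_j\le\theta\}$ and $\{c\in C_u: c_j>\theta\}$ are non-empty, into a left child (the part $x_j\le\theta$ of the cell of $u$, with the first set of centers) and a right child (the part $x_j>\theta$, with the second set). With probability $1$ the algorithm stops, and its output is a threshold decision tree $\mathcal{T}$ with $k$ leaves such that the cell of each leaf contains exactly one of the centers, the one assigned to that leaf. For a finite data set $X$ of points of $\mathbb{R}^d$ (repetitions allowed), let $P_1,\dots,P_k$ be the partition of $X$ into the cells of the leaves of $\mathcal{T}$, and let $$\operatorname{cost}(X,\mathcal{T})=\sum_{i=1}^k\min_{\hat c\in\mathbb{R}^d}\sum_{x\in P_i}\|x-\hat c\|_1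 .$$ Then the competitive ratio of \textsc{RandomCoordinateCut} for explainable $k$-medians in $\ell_1$ is at most $2\ln k+2$; that is, for every such $C$ and $X$, the expected cost is finite and $$\mathbf{E}[\operatorname{cost}(X,\mathcal{T})]\le(2\ln k+2)\sum_{x\in X}\min_{1\le i\le k}\|x-c^i\|_1 .$$ -/

import Mathlib

open MeasureTheory ProbabilityTheory

/-- The space `ℝ^d` with the norm `‖x‖₁ = ∑ j, |x j|`. -/
abbrev L1Space (d : ℕ) : Type := PiLp 1 (fun _ : Fin d => ℝ)

/-- Binary threshold decision trees on `ℝ^d`. An inner node carries a threshold cut `(j, θ)`: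
points with `x j ≤ θ` go to the left subtree, points with `x j > θ` go to the right subtree.
Each leaf `u` carries a finite set `C_u` of reference centers assigned to it. -/
inductive ThresholdTree (d : ℕ) : Type
  | leaf (centers : Finset (L1Space d)) : ThresholdTree d
  | node (j : Fin d) (θ : ℝ) (left right : ThresholdTree d) : ThresholdTree d

namespace ThresholdTree

variable {d : ℕ}

/-- The sets of centers assigned to the leaves, from left to right. -/
def leafCenters : ThresholdTree d → List (Finset (L1Space d))
  | leaf S => [S]
  | node _ _ l r => l.leafCenters ++ r.leafCenters

/-- The number of leaves. -/
def numLeaves : ThresholdTree d → ℕ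
  | leaf _ => 1
  | node _ _ l r => l.numLeaves + r.numLeaves

/-- The partition of a finite family of points into the groups that end up in the individual
leaves of the tree, one group (possibly empty) for each leaf, from left to right. -/
noncomputable def clusters : ThresholdTree d → Multiset (L1Space d) → List (Multiset (L1Space d))
  | leaf _, X => [X]
  | node j θ l r, X =>
      l.clusters (X.filter fun x => x j ≤ θ) ++ r.clusters (X.filter fun x => θ < x j)

/-- One round: split every leaf by the cut `ω = (j, θ)`, except the leaves all of whose centers
lie on one side of the cut. -/
noncomputable def split (ω : Fin d × ℝ) : ThresholdTree d → ThresholdTree d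
  | leaf S =>
      if (S.filter fun c => c ω.1 ≤ ω.2).Nonempty ∧ (S.filter fun c => ω.2 < c ω.1).Nonempty then
        node ω.1 ω.2 (leaf (S.filter fun c => c ω.1 ≤ ω.2)) (leaf (S.filter fun c => ω.2 < c ω.1))
      else leaf S
  | node j θ l r => node j θ (l.split ω) (r.split ω)

end ThresholdTree

/-- The 1-median cost of a cluster `P`: the minimum over all `c` of `∑ x ∈ P, ‖x - c‖₁`. -/
noncomputable def medianCost {d : ℕ} (P : Multiset (L1Space d)) : ℝ :=
  ⨅ c : L1Space d, (P.map fun x => ‖x - c‖).sum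

/-- The `k`-medians cost of the clustering of `X` that is produced by a threshold decision tree. -/
noncomputable def ThresholdTree.cost {d : ℕ} (T : ThresholdTree d) (X : Multiset (L1Space d)) : ℝ :=
  ((T.clusters X).map medianCost).sum

namespace RandomCoordinateCut

variable {d : ℕ}

/-- `M`, the maximum of `|c j|` over all centers `c` and all coordinates `j`. -/
noncomputable def maxAbs (C : Finset (L1Space d)) : ℝ :=
  ((C.sup fun c => Finset.univ.sup fun j => ‖c j‖₊ : NNReal) : ℝ)

/-- The uniform distribution on `(-M, M)`. If `M = 0`, then all centers coincide and the algorithm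
never draws a cut; the (irrelevant) law is then the Dirac mass at `0`. -/
noncomputable def thresholdLaw (M : ℝ) : Measure ℝ :=
  if 0 < M then volume[|Set.Ioo (-M) M] else Measure.dirac 0

instance (M : ℝ) : IsProbabilityMeasure (thresholdLaw M) := by
  unfold thresholdLaw
  split_ifs with h
  · apply cond_isProbabilityMeasure_of_finite
    · simp only [Real.volume_Ioo, ne_eq, ENNReal.ofReal_eq_zero, not_le]
      linarith
    · simp
  · infer_instance

/-- The law of a single random cut `(j, θ)`: the coordinate `j` is uniform on the `d` coordinates
and, independently, `θ` is uniform on `(-M, M)`. -/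
noncomputable def cutLaw (C : Finset (L1Space d)) : Measure (Fin d × ℝ) :=
  (uniformOn (Set.univ : Set (Fin d))).prod (thresholdLaw (maxAbs C))

instance [NeZero d] (C : Finset (L1Space d)) : IsProbabilityMeasure (cutLaw C) := by
  have : IsProbabilityMeasure (uniformOn (Set.univ : Set (Fin d))) :=
    isProbabilityMeasure_uniformOn Set.finite_univ Set.univ_nonempty
  unfold cutLaw
  infer_instance

/-- The law of the sequence `ω 0, ω 1, …` of independent identically distributed random cuts. -/
noncomputable def drawLaw [NeZero d] (C : Finset (L1Space d)) : Measure (ℕ → Fin d × ℝ) :=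
  Measure.infinitePi fun _ => cutLaw C

/-- The tree after `n` rounds with the cuts `ω 0, …, ω (n - 1)`. -/
noncomputable def treeAfter (C : Finset (L1Space d)) (ω : ℕ → Fin d × ℝ) : ℕ → ThresholdTree d
  | 0 => ThresholdTree.leaf C
  | n + 1 => (treeAfter C ω n).split (ω n)

/-- The loop condition fails after `n` rounds: no leaf has two distinct centers. -/
def Stops (C : Finset (L1Space d)) (ω : ℕ → Fin d × ℝ) (n : ℕ) : Prop :=
  ∀ S ∈ (treeAfter C ω n).leafCenters, ¬ 2 ≤ S.card

open Classical in
/-- The output of the algorithm on the centers `C` with the random cuts `ω`: the tree after the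
first round at which the loop condition fails. (If the loop runs forever, the value is the initial
tree.) -/
noncomputable def output (C : Finset (L1Space d)) (ω : ℕ → Fin d × ℝ) : ThresholdTree d :=
  if h : ∃ n, Stops C ω n then treeAfter C ω (Nat.find h) else ThresholdTree.leaf C

end RandomCoordinateCut

/-!
The cost of the output is at most the sum, over the points `x` of `X`, of the distance of `x` from
the center of its leaf, so a single point `x` can be considered. A cut *hits* the centers that it
separates from `x`, and the set of centers in the leaf of `x` evolves as in an elimination game
(`survivors`): the players that are hit leave, unless all of them are hit. The distance of `x` from
a center `c` is `r + l * p c`, where `p c` is the probability that a cut hits `c` and `r` is the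
distance of `x` from the box of the thresholds (`exists_norm_sub_eq_affine`). It thus suffices to
bound the expected value of `p w`, for the winner `w`, by `(ln k + 2) * p o`, for any center `o`.

Let `p' i` be the probability that a cut hits `i` but not `o`, so that `p i ≤ p o + p' i` and
`p' o = 0`. If `o` is not the winner, it is removed by some cut `g` that hits it. Up to that moment
the players that `g` misses have evolved as in the game without `o`, and afterwards they play
on alone. As `g` may come in any round, the expected value of `p' w` is at most
`∑ g ∋ o, q g * E[p' w * σ]`, where `q g` is the probability of the cut `g` and `w` is the winner of
the game among the players that `g` misses (`payoff_le_sum_durationPayoff`). The duration `σ` of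
that game ends with a cut that misses `o` and hits all remaining players, `w` among them. Hence `σ`
is at most the first time `T w` at which a cut that misses `o` hits `w`, and
`p' w * σ ≤ max_i p' i * T i`. As `T i` is geometric with mean `1 / p' i`, the maximum has
expectation at most `ln k + 1` (`durationPayoff_le`). The sum of the `q g` is `p o`, and the total
is at most `p o + p o * (ln k + 1)` (`payoff_minVal_le`).

Every two centers are separated by a cut with positive probability, so the loop stops almost surely
(`ae_exists_stops`). The cost and the leaf of `x` after `n` rounds depend only on finitely many
comparisons of coordinates with thresholds, which makes them measurable
(`measurable_of_cutType`), and dominated convergence passes from `n` rounds to the output.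
-/

/-! ### The elimination game -/

section EliminationGame

variable {ι : Type*}

/-- The least value of `w` on `S`, with value `0` on the empty set. -/
noncomputable def minVal (w : ι → ℝ) (S : Finset ι) : ℝ :=
  if hS : S.Nonempty then S.inf' hS w else 0

theorem minVal_empty (w : ι → ℝ) : minVal w ∅ = 0 := by simp [minVal]

theorem minVal_le (w : ι → ℝ) {S : Finset ι} {i : ι} (hi : i ∈ S) : minVal w S ≤ w i := by
  unfold minVal
  rw [dif_pos ⟨i, hi⟩]
  exact Finset.inf'_le w hi

theorem exists_minVal_eq (w : ι → ℝ) {S : Finset ι} (hS : S.Nonempty) :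
    ∃ i ∈ S, minVal w S = w i := by
  unfold minVal
  rw [dif_pos hS]
  exact Finset.exists_mem_eq_inf' hS w

theorem minVal_singleton (w : ι → ℝ) (i : ι) : minVal w {i} = w i := by simp [minVal]

theorem minVal_nonneg {w : ι → ℝ} (hw : ∀ i, 0 ≤ w i) (S : Finset ι) : 0 ≤ minVal w S := by
  rcases S.eq_empty_or_nonempty with rfl | hS
  · rw [minVal_empty]
  · obtain ⟨i, -, hi⟩ := exists_minVal_eq w hS
    exact hi ▸ hw i

variable [DecidableEq ι]

/-- One round of the elimination game: the players hit by the cut are removed from `S`, unless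
all of them are hit, in which case nothing happens. -/
def survivors (h S : Finset ι) : Finset ι :=
  if (S \ h).Nonempty then S \ h else S

theorem survivors_subset (h S : Finset ι) : survivors h S ⊆ S := by
  unfold survivors
  split_ifs
  · exact Finset.sdiff_subset
  · exact Finset.Subset.refl _

theorem survivors_nonempty (h : Finset ι) {S : Finset ι} (hS : S.Nonempty) :
    (survivors h S).Nonempty := by
  unfold survivors
  split_ifs with h1
  · exact h1
  · exact hS

theorem survivors_empty (h : Finset ι) : survivors h ∅ = ∅ := by
  simp [survivors]

theorem minVal_le_survivors (w : ι → ℝ) (h S : Finset ι) :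
    minVal w S ≤ minVal w (survivors h S) := by
  rcases S.eq_empty_or_nonempty with rfl | hS
  · rw [survivors_empty]
  · obtain ⟨i, hi, e⟩ := exists_minVal_eq w (survivors_nonempty h hS)
    exact e ▸ minVal_le w (survivors_subset h S hi)

/-- The expected value of `a` at the set of players left after `N` independent rounds that start
from `S`; in each round the set of hit players is `h ∈ H` with probability `q h`. -/
def payoff (H : Finset (Finset ι)) (q : Finset ι → ℝ) (a : Finset ι → ℝ) :
    ℕ → Finset ι → ℝ
  | 0, S => a S
  | N + 1, S => ∑ h ∈ H, q h * payoff H q a N (survivors h S)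

/-- The probability that a cut hits player `i`. -/
def hitProb (H : Finset (Finset ι)) (q : Finset ι → ℝ) (i : ι) : ℝ :=
  ∑ h ∈ H with i ∈ h, q h

/-- The probability that a cut hits player `i` but not player `o`. -/
def hitProbAvoiding (H : Finset (Finset ι)) (q : Finset ι → ℝ) (o i : ι) : ℝ :=
  ∑ h ∈ H with i ∈ h ∧ o ∉ h, q h

/-- An upper bound for the expected value of `(payoff of the winner) × (duration)` in the game
started from `B`, up to horizon `N`. The duration ends once a cut that misses `o` hits all
remaining players. -/
def durationPayoff (H : Finset (Finset ι)) (q : Finset ι → ℝ) (a : Finset ι → ℝ) (o : ι) :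
    ℕ → Finset ι → ℝ
  | 0, _ => 0
  | N + 1, B => payoff H q a N B + ∑ h ∈ H, q h *
      (if o ∈ h then durationPayoff H q a o N (survivors h B)
        else durationPayoff H q a o N (B \ h))

variable {H : Finset (Finset ι)} {q : Finset ι → ℝ} {a b : Finset ι → ℝ}

theorem payoff_empty (ha : a ∅ = 0) (N : ℕ) : payoff H q a N ∅ = 0 := by
  induction N with
  | zero => exact ha
  | succ N ih => simp [payoff, survivors_empty, ih]

theorem durationPayoff_empty (ha : a ∅ = 0) (o : ι) (N : ℕ) :
    durationPayoff H q a o N ∅ = 0 := by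
  induction N with
  | zero => rfl
  | succ N ih => simp [durationPayoff, payoff_empty ha, survivors_empty, ih]

/-- The first round and the last round of a game of `N + 1` rounds can be split off alike. -/
theorem payoff_average (H : Finset (Finset ι)) (q : Finset ι → ℝ)
    (a : Finset ι → ℝ) (N : ℕ) (S : Finset ι) :
    payoff H q (fun S => ∑ h ∈ H, q h * a (survivors h S)) N S = payoff H q a (N + 1) S := by
  induction N generalizing S with
  | zero => rfl
  | succ N ih =>
    rw [payoff, payoff]
    exact Finset.sum_congr rfl fun h _ => by rw [ih]

theorem payoff_nonneg (hq : ∀ h ∈ H, 0 ≤ q h) (ha : ∀ S, 0 ≤ a S) (N : ℕ) (S : Finset ι) :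
    0 ≤ payoff H q a N S := by
  induction N generalizing S with
  | zero => exact ha S
  | succ N ih => exact Finset.sum_nonneg fun h hh => mul_nonneg (hq h hh) (ih _)

theorem durationPayoff_nonneg (hq : ∀ h ∈ H, 0 ≤ q h) (ha : ∀ S, 0 ≤ a S) (o : ι) (N : ℕ)
    (S : Finset ι) : 0 ≤ durationPayoff H q a o N S := by
  induction N generalizing S with
  | zero => exact le_rfl
  | succ N ih =>
    refine add_nonneg (payoff_nonneg hq ha N S)
      (Finset.sum_nonneg fun h hh => mul_nonneg (hq h hh) ?_)
    split_ifs <;> exact ih _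

theorem payoff_le_succ (hq : ∀ h ∈ H, 0 ≤ q h) (hq1 : ∑ h ∈ H, q h = 1)
    (ha : ∀ h S, a S ≤ a (survivors h S)) (N : ℕ) (S : Finset ι) :
    payoff H q a N S ≤ payoff H q a (N + 1) S := by
  induction N generalizing S with
  | zero =>
    calc a S = ∑ h ∈ H, q h * a S := by rw [← Finset.sum_mul, hq1, one_mul]
      _ ≤ _ := Finset.sum_le_sum fun h hh => mul_le_mul_of_nonneg_left (ha h S) (hq h hh)
  | succ N ih =>
    exact Finset.sum_le_sum fun h hh => mul_le_mul_of_nonneg_left (ih _) (hq h hh)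

theorem payoff_le_affine (hq : ∀ h ∈ H, 0 ≤ q h) (hq1 : ∑ h ∈ H, q h = 1) {α β : ℝ}
    (A : Finset ι) (hab : ∀ S ⊆ A, S.Nonempty → a S ≤ α + β * b S) (N : ℕ) {S : Finset ι}
    (hSA : S ⊆ A) (hS : S.Nonempty) :
    payoff H q a N S ≤ α + β * payoff H q b N S := by
  induction N generalizing S with
  | zero => exact hab S hSA hS
  | succ N ih =>
    calc payoff H q a (N + 1) S
        ≤ ∑ h ∈ H, q h * (α + β * payoff H q b N (survivors h S)) :=
          Finset.sum_le_sum fun h hh => mul_le_mul_of_nonneg_left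
            (ih ((survivors_subset h S).trans hSA) (survivors_nonempty h hS)) (hq h hh)
      _ = (∑ h ∈ H, q h) * α + β * payoff H q b (N + 1) S := by
          rw [payoff, Finset.sum_mul, Finset.mul_sum, ← Finset.sum_add_distrib]
          exact Finset.sum_congr rfl fun h _ => by ring
      _ = _ := by rw [hq1, one_mul]

theorem payoff_minVal_le_sup (hq : ∀ h ∈ H, 0 ≤ q h) (hq1 : ∑ h ∈ H, q h = 1) {w : ι → ℝ}
    {m : ℝ} (N : ℕ) {S : Finset ι} (hS : S.Nonempty) (hm : ∀ i ∈ S, w i ≤ m) :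
    payoff H q (minVal w) N S ≤ m := by
  have h := payoff_le_affine (a := minVal w) (b := fun _ => 0) (α := m) (β := 0) hq hq1 S
    (fun T hT hT' => by
      obtain ⟨i, hi, e⟩ := exists_minVal_eq w hT'
      rw [e]
      simpa using hm i (hT hi)) N (Finset.Subset.refl S) hS
  simpa using h

/-- As long as `o` is in the game, the other players are removed as in the game without `o`. If a
cut `g` is the one that removes `o`, the game goes on among the players that `g` misses, so
that the payoff is collected at rate `q g` for as long as one of those players is left. -/
theorem payoff_le_sum_durationPayoff (hq : ∀ h ∈ H, 0 ≤ q h) (ha : ∀ S, 0 ≤ a S)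
    (ha0 : a ∅ = 0) {o : ι} (hao : ∀ S, o ∈ S → a S = 0) (N : ℕ) {A : Finset ι} (hA : o ∈ A) :
    payoff H q a N A ≤ ∑ g ∈ H with o ∈ g, q g * durationPayoff H q a o N (A \ g) := by
  induction N generalizing A with
  | zero => simp [payoff, durationPayoff, hao A hA]
  | succ N ih =>
    set R : Finset ι → ℝ := fun h =>
      ∑ g ∈ H with o ∈ g, q g * (if o ∈ h then durationPayoff H q a o N (survivors h (A \ g))
        else durationPayoff H q a o N ((A \ g) \ h)) with hR
    have hRnn : ∀ h, 0 ≤ R h := fun h => Finset.sum_nonneg fun g hg =>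
      mul_nonneg (hq g (Finset.mem_filter.1 hg).1)
        (by split_ifs <;> exact durationPayoff_nonneg hq ha o N _)
    have key : ∀ h ∈ H, payoff H q a N (survivors h A) ≤
        (if o ∈ h then payoff H q a N (A \ h) else 0) + R h := by
      intro h hh
      by_cases ho : o ∈ h
      · rw [if_pos ho]
        by_cases hne : (A \ h).Nonempty
        · have : survivors h A = A \ h := if_pos hne
          rw [this]
          exact le_add_of_nonneg_right (hRnn h)
        · -- All players are hit, `o` among them: nothing changes, in either game.
          have e : survivors h A = A := if_neg hne
          rw [Finset.not_nonempty_iff_eq_empty] at hne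
          rw [hne, payoff_empty ha0, zero_add, e]
          refine (ih hA).trans (le_of_eq (Finset.sum_congr rfl fun g _ => ?_))
          rw [if_pos ho]
          have : survivors h (A \ g) = A \ g := by
            apply if_neg
            rw [Finset.not_nonempty_iff_eq_empty, Finset.sdiff_eq_empty_iff_subset]
            exact Finset.sdiff_subset.trans (Finset.sdiff_eq_empty_iff_subset.1 hne)
          rw [this]
      · rw [if_neg ho, zero_add]
        have hoA : o ∈ A \ h := Finset.mem_sdiff.2 ⟨hA, ho⟩
        have e : survivors h A = A \ h := if_pos ⟨o, hoA⟩
        rw [e]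
        refine (ih hoA).trans (le_of_eq (Finset.sum_congr rfl fun g _ => ?_))
        rw [if_neg ho, sdiff_right_comm]
    calc payoff H q a (N + 1) A
        ≤ ∑ h ∈ H, q h * ((if o ∈ h then payoff H q a N (A \ h) else 0) + R h) :=
          Finset.sum_le_sum fun h hh => mul_le_mul_of_nonneg_left (key h hh) (hq h hh)
      _ = (∑ g ∈ H with o ∈ g, q g * payoff H q a N (A \ g)) + ∑ h ∈ H, q h * R h := by
          rw [Finset.sum_filter, ← Finset.sum_add_distrib]
          refine Finset.sum_congr rfl fun h _ => ?_
          split_ifs <;> ring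
      _ = _ := by
          simp only [durationPayoff, mul_add, Finset.sum_add_distrib]
          congr 1
          simp only [hR, Finset.mul_sum]
          rw [Finset.sum_comm]
          exact Finset.sum_congr rfl fun g _ => Finset.sum_congr rfl fun h _ => by ring

/-- The expected overshoot `E[max (t + Z) 0]` for an exponential random variable `Z` of
mean `1`. -/
noncomputable def expOvershoot (t : ℝ) : ℝ := if t ≤ 0 then Real.exp t else 1 + t

theorem max_le_expOvershoot (t : ℝ) : max t 0 ≤ expOvershoot t := by
  unfold expOvershoot
  split_ifs with h
  · rw [max_eq_right h]
    exact (Real.exp_pos t).le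
  · rw [max_eq_left (not_le.1 h).le]
    linarith

theorem expOvershoot_nonneg (t : ℝ) : 0 ≤ expOvershoot t :=
  (le_max_right t 0).trans (max_le_expOvershoot t)

/-- The geometric waiting time with success probability `p`, rescaled by `p`, has no larger
overshoots than the exponential one. -/
theorem expOvershoot_step {p : ℝ} (hp0 : 0 ≤ p) (t : ℝ) :
    (1 - p) * expOvershoot (t + p) + p * max (t + p) 0 ≤ expOvershoot t := by
  unfold expOvershoot
  have h1 := Real.add_one_le_exp t
  have h2 := Real.add_one_le_exp (-p)
  split_ifs with h h' h'
  · rw [max_eq_right h, mul_zero, add_zero]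
    calc (1 - p) * Real.exp (t + p) ≤ Real.exp (-p) * Real.exp (t + p) :=
          mul_le_mul_of_nonneg_right (by linarith) (Real.exp_pos _).le
      _ = Real.exp t := by rw [← Real.exp_add]; congr 1; ring
  · exact absurd (by linarith) h'
  · rw [max_eq_left (not_le.1 h).le]
    nlinarith
  · rw [max_eq_left (not_le.1 h).le]
    nlinarith

theorem hitProbAvoiding_nonneg (hq : ∀ h ∈ H, 0 ≤ q h) (o i : ι) :
    0 ≤ hitProbAvoiding H q o i :=
  Finset.sum_nonneg fun h hh => hq h (Finset.mem_filter.1 hh).1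

/-- Suppose that the game has lasted `s` rounds when the players `B` are left. The expected value of `w (winner) * duration` is at
most that of `max w i * T i`, where `T i` is the first time at which a cut avoiding `o` hits `i`;
and this maximum is at most `L` plus the sum of the overshoots over `L`. -/
theorem durationPayoff_le (hq : ∀ h ∈ H, 0 ≤ q h) (hq1 : ∑ h ∈ H, q h = 1) (o : ι) {L : ℝ}
    (hL : 0 ≤ L) (N : ℕ) {s : ℝ} (hs : 0 ≤ s) (B : Finset ι) :
    s * payoff H q (minVal (hitProbAvoiding H q o)) N B +
        durationPayoff H q (minVal (hitProbAvoiding H q o)) o N B ≤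
      L + ∑ i ∈ B, expOvershoot (hitProbAvoiding H q o i * s - L) := by
  set w := hitProbAvoiding H q o with hw
  have hw0 : ∀ i, 0 ≤ w i := hitProbAvoiding_nonneg hq o
  have hbound : ∀ {s : ℝ} {B : Finset ι} (N : ℕ), 0 ≤ s → B.Nonempty →
      s * payoff H q (minVal w) N B ≤ L + ∑ i ∈ B, max (w i * s - L) 0 := by
    intro s B N hs hB
    obtain ⟨i, hi, hmax⟩ := Finset.exists_max_image B w hB
    have h1 := mul_le_mul_of_nonneg_left (payoff_minVal_le_sup hq hq1 N hB hmax) hs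
    have h2 : max (w i * s - L) 0 ≤ ∑ i ∈ B, max (w i * s - L) 0 :=
      Finset.single_le_sum (f := fun i => max (w i * s - L) 0)
        (fun j _ => le_max_right _ _) hi
    have h3 := le_max_left (w i * s - L) 0
    linarith
  rcases B.eq_empty_or_nonempty with rfl | hB
  · rw [payoff_empty (minVal_empty w), durationPayoff_empty (minVal_empty w)]
    simpa using hL
  induction N generalizing s B with
  | zero =>
    have h1 := hbound 0 hs hB
    have h2 : ∑ i ∈ B, max (w i * s - L) 0 ≤ ∑ i ∈ B, expOvershoot (w i * s - L) :=
      Finset.sum_le_sum fun i _ => max_le_expOvershoot _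
    simp only [durationPayoff]
    linarith
  | succ N ih =>
    have hs1 : 0 ≤ s + 1 := by linarith
    -- The contribution of player `i` after the cut `h`.
    set v : Finset ι → ι → ℝ := fun h i =>
      if i ∈ h ∧ o ∉ h then max (w i * (s + 1) - L) 0 else expOvershoot (w i * (s + 1) - L)
      with hv
    have hv0 : ∀ h i, 0 ≤ v h i := by
      intro h i
      simp only [hv]
      split_ifs
      · exact le_max_right _ _
      · exact expOvershoot_nonneg _
    have hsub : ∀ h B', B' ⊆ B → (∀ i ∈ B', ¬ (i ∈ h ∧ o ∉ h)) →
        ∑ i ∈ B', expOvershoot (w i * (s + 1) - L) ≤ ∑ i ∈ B, v h i := by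
      intro h B' hB' hi
      calc ∑ i ∈ B', expOvershoot (w i * (s + 1) - L) = ∑ i ∈ B', v h i :=
            Finset.sum_congr rfl fun i hiB => by simp only [hv]; rw [if_neg (hi i hiB)]
        _ ≤ _ := Finset.sum_le_sum_of_subset_of_nonneg hB' fun i _ _ => hv0 h i
    have key : ∀ h ∈ H, (s + 1) * payoff H q (minVal w) N (survivors h B) +
        (if o ∈ h then durationPayoff H q (minVal w) o N (survivors h B)
          else durationPayoff H q (minVal w) o N (B \ h)) ≤ L + ∑ i ∈ B, v h i := by
      intro h _
      by_cases ho : o ∈ h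
      · rw [if_pos ho]
        refine (ih hs1 _ (survivors_nonempty h hB)).trans ?_
        have := hsub h (survivors h B) (survivors_subset h B) (fun i _ hi => hi.2 ho)
        linarith
      · rw [if_neg ho]
        by_cases hne : (B \ h).Nonempty
        · have e : survivors h B = B \ h := if_pos hne
          rw [e]
          refine (ih hs1 _ hne).trans ?_
          have := hsub h (B \ h) Finset.sdiff_subset
            (fun i hi hi' => (Finset.mem_sdiff.1 hi).2 hi'.1)
          linarith
        · -- The duration ends here: the winner is hit by a cut that avoids `o`.
          have e : survivors h B = B := if_neg hne
          rw [Finset.not_nonempty_iff_eq_empty] at hne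
          rw [hne, e, durationPayoff_empty (minVal_empty w), add_zero]
          refine (hbound N hs1 hB).trans (le_of_eq ?_)
          congr 1
          refine Finset.sum_congr rfl fun i hi => ?_
          simp only [hv]
          rw [if_pos ⟨Finset.sdiff_eq_empty_iff_subset.1 hne hi, ho⟩]
    have havg : ∀ i, ∑ h ∈ H, q h * v h i ≤ expOvershoot (w i * s - L) := by
      intro i
      have hc : ∑ h ∈ H with ¬ (i ∈ h ∧ o ∉ h), q h = 1 - w i := by
        rw [← hq1, ← Finset.sum_filter_add_sum_filter_not H (fun h => i ∈ h ∧ o ∉ h) q]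
        simp [hw, hitProbAvoiding]
      have : ∑ h ∈ H, q h * v h i =
          w i * max (w i * (s + 1) - L) 0 + (1 - w i) * expOvershoot (w i * (s + 1) - L) := by
        rw [← Finset.sum_filter_add_sum_filter_not H (fun h => i ∈ h ∧ o ∉ h)
          (fun h => q h * v h i), ← hc, Finset.sum_mul]
        have hwi : w i = ∑ h ∈ H with i ∈ h ∧ o ∉ h, q h := rfl
        congr 1
        · conv_rhs => rw [hwi, Finset.sum_mul, ← hwi]
          refine Finset.sum_congr rfl fun h hh => ?_
          simp only [hv]
          rw [if_pos (Finset.mem_filter.1 hh).2]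
        · refine Finset.sum_congr rfl fun h hh => ?_
          simp only [hv]
          rw [if_neg (Finset.mem_filter.1 hh).2]
      rw [this]
      have h1 := expOvershoot_step (hw0 i) (w i * s - L)
      have h2 : w i * s - L + w i = w i * (s + 1) - L := by ring
      rw [h2] at h1
      linarith
    -- The rate at which the payoff is collected may be evaluated one round later.
    have hmono := payoff_le_succ hq hq1 (minVal_le_survivors w) N B
    calc s * payoff H q (minVal w) (N + 1) B + durationPayoff H q (minVal w) o (N + 1) B
        ≤ (s + 1) * payoff H q (minVal w) (N + 1) B + ∑ h ∈ H, q h *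
          (if o ∈ h then durationPayoff H q (minVal w) o N (survivors h B)
            else durationPayoff H q (minVal w) o N (B \ h)) := by
          rw [durationPayoff]
          linarith
      _ = ∑ h ∈ H, q h * ((s + 1) * payoff H q (minVal w) N (survivors h B) +
          (if o ∈ h then durationPayoff H q (minVal w) o N (survivors h B)
            else durationPayoff H q (minVal w) o N (B \ h))) := by
          rw [payoff, Finset.mul_sum, ← Finset.sum_add_distrib]
          exact Finset.sum_congr rfl fun h _ => by ring
      _ ≤ ∑ h ∈ H, q h * (L + ∑ i ∈ B, v h i) :=
          Finset.sum_le_sum fun h hh => mul_le_mul_of_nonneg_left (key h hh) (hq h hh)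
      _ = L + ∑ i ∈ B, ∑ h ∈ H, q h * v h i := by
          simp only [mul_add, Finset.sum_add_distrib, ← Finset.sum_mul, hq1, one_mul,
            Finset.mul_sum]
          rw [Finset.sum_comm]
      _ ≤ _ := by
          have := Finset.sum_le_sum fun i (_ : i ∈ B) => havg i
          linarith

/-- The competitive ratio of the elimination game: if the values `D i` are affine in the hitting
probabilities, the expected value of the winner is at most `ln k + 2` times any single value. The
threshold `L = ln k` balances `L` against the total overshoot `k * exp (-L)`. -/
theorem payoff_minVal_le (hq : ∀ h ∈ H, 0 ≤ q h) (hq1 : ∑ h ∈ H, q h = 1) {D : ι → ℝ}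
    {r l : ℝ} (hr : 0 ≤ r) (hl : 0 ≤ l) {A : Finset ι}
    (hD : ∀ i ∈ A, D i = r + l * hitProb H q i) {o : ι} (ho : o ∈ A) (N : ℕ) :
    payoff H q (minVal D) N A ≤ (Real.log A.card + 2) * D o := by
  set w := hitProbAvoiding H q o with hw
  have hw0 : ∀ i, 0 ≤ w i := hitProbAvoiding_nonneg hq o
  have hp0 : 0 ≤ hitProb H q o :=
    Finset.sum_nonneg fun h hh => hq h (Finset.mem_filter.1 hh).1
  have hcard : (1 : ℝ) ≤ A.card := by exact_mod_cast Finset.card_pos.2 ⟨o, ho⟩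
  have hL : 0 ≤ Real.log A.card := Real.log_nonneg hcard
  have hpw : ∀ i, hitProb H q i ≤ hitProb H q o + w i := by
    intro i
    simp only [hw, hitProb, hitProbAvoiding, Finset.sum_filter]
    rw [← Finset.sum_add_distrib]
    refine Finset.sum_le_sum fun h hh => ?_
    have := hq h hh
    split_ifs <;> first | linarith | (exfalso; tauto)
  have hwo : w o = 0 := by
    simp only [hw, hitProbAvoiding]
    rw [Finset.filter_false_of_mem (by tauto), Finset.sum_empty]
  have haff := payoff_le_affine (a := minVal D) (b := minVal w) (α := r + l * hitProb H q o)
    (β := l) hq hq1 A (by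
      intro S hSA hS
      obtain ⟨i, hi, e⟩ := exists_minVal_eq w hS
      have h1 := minVal_le D hi
      rw [hD i (hSA hi)] at h1
      rw [e]
      nlinarith [mul_le_mul_of_nonneg_left (hpw i) hl]) N (Finset.Subset.refl A) ⟨o, ho⟩
  have hdur : ∀ g, durationPayoff H q (minVal w) o N (A \ g) ≤ Real.log A.card + 1 := by
    intro g
    have h := durationPayoff_le hq hq1 o hL N le_rfl (A \ g)
    have hexp : expOvershoot (-Real.log A.card) = (A.card : ℝ)⁻¹ := by
      rw [expOvershoot, if_pos (by linarith), Real.exp_neg, Real.exp_log (by linarith)]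
    simp only [zero_mul, zero_add, mul_zero, zero_sub, hexp, Finset.sum_const,
      nsmul_eq_mul] at h
    have hc : (((A \ g).card : ℕ) : ℝ) ≤ A.card := by
      exact_mod_cast Finset.card_le_card Finset.sdiff_subset
    have h2 : ((A \ g).card : ℝ) * (A.card : ℝ)⁻¹ ≤ 1 := by
      rw [← div_eq_mul_inv]
      exact div_le_one_of_le₀ hc (by linarith)
    linarith
  have hmain : payoff H q (minVal w) N A ≤ hitProb H q o * (Real.log A.card + 1) := by
    refine (payoff_le_sum_durationPayoff hq (minVal_nonneg hw0) (minVal_empty w)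
      (fun S hS => le_antisymm (hwo ▸ minVal_le w hS) (minVal_nonneg hw0 S)) N ho).trans ?_
    rw [hitProb, Finset.sum_mul]
    exact Finset.sum_le_sum fun g hg =>
      mul_le_mul_of_nonneg_left (hdur g) (hq g (Finset.mem_filter.1 hg).1)
  rw [hD o ho]
  have h1 := mul_le_mul_of_nonneg_left hmain hl
  have h2 := mul_nonneg hL hr
  nlinarith

end EliminationGame

/-! ### Threshold trees -/

namespace ThresholdTree

variable {d : ℕ}

/-- The set of centers assigned to the leaf whose cell contains `x`. -/
noncomputable def locate : ThresholdTree d → L1Space d → Finset (L1Space d)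
  | leaf S, _ => S
  | node j θ l r, x => if x j ≤ θ then l.locate x else r.locate x

/-- The tree distributes the centers in `S` to its leaves according to its cuts. -/
def Distributes : ThresholdTree d → Finset (L1Space d) → Prop
  | leaf S', S => S' = S
  | node j θ l r, S =>
      l.Distributes (S.filter fun c => c j ≤ θ) ∧ r.Distributes (S.filter fun c => θ < c j)

theorem Distributes.split {T : ThresholdTree d} {S : Finset (L1Space d)}
    (hT : T.Distributes S) (ω : Fin d × ℝ) : (T.split ω).Distributes S := by
  induction T generalizing S with
  | leaf S' =>
    obtain rfl : S' = S := hT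
    rw [ThresholdTree.split]
    split_ifs
    · exact ⟨rfl, rfl⟩
    · rfl
  | node j θ l r ihl ihr => exact ⟨ihl hT.1, ihr hT.2⟩

theorem Distributes.clusters_val {T : ThresholdTree d} {S : Finset (L1Space d)}
    (hT : T.Distributes S) : T.clusters S.val = T.leafCenters.map Finset.val := by
  induction T generalizing S with
  | leaf S' =>
    obtain rfl : S' = S := hT
    rfl
  | node j θ l r ihl ihr =>
    have hl := ihl hT.1
    have hr := ihr hT.2
    simp only [Finset.filter_val] at hl hr
    simp [clusters, leafCenters, hl, hr]

theorem Distributes.sum_card {T : ThresholdTree d} {S : Finset (L1Space d)}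
    (hT : T.Distributes S) : (T.leafCenters.map Finset.card).sum = S.card := by
  induction T generalizing S with
  | leaf S' =>
    obtain rfl : S' = S := hT
    simp [leafCenters]
  | node j θ l r ihl ihr =>
    have h := S.card_filter_add_card_filter_not (fun c : L1Space d => c j ≤ θ)
    simp only [not_le] at h
    simp [leafCenters, ihl hT.1, ihr hT.2, h]

theorem length_leafCenters (T : ThresholdTree d) : T.leafCenters.length = T.numLeaves := by
  induction T with
  | leaf S => rfl
  | node j θ l r ihl ihr => simp [leafCenters, numLeaves, ihl, ihr]

theorem Distributes.numLeaves_eq_card {T : ThresholdTree d} {S : Finset (L1Space d)}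
    (hT : T.Distributes S) (h1 : ∀ L ∈ T.leafCenters, L.card = 1) : T.numLeaves = S.card := by
  rw [← hT.sum_card, ← length_leafCenters,
    List.map_congr_left (g := fun _ => 1) (fun L hL => h1 L hL)]
  simp

theorem nonempty_of_mem_leafCenters_split {T : ThresholdTree d} (ω : Fin d × ℝ)
    (hT : ∀ S ∈ T.leafCenters, S.Nonempty) : ∀ S ∈ (T.split ω).leafCenters, S.Nonempty := by
  induction T with
  | leaf S =>
    rw [split]
    split_ifs with h
    · simp [leafCenters, h.1, h.2]
    · exact hT
  | node j θ l r ihl ihr =>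
    simp only [leafCenters, List.mem_append] at hT
    simp only [split, leafCenters, List.mem_append]
    rintro S (hS | hS)
    · exact ihl (fun S hS => hT S (Or.inl hS)) S hS
    · exact ihr (fun S hS => hT S (Or.inr hS)) S hS

theorem split_eq_self {T : ThresholdTree d} (ω : Fin d × ℝ)
    (hT : ∀ S ∈ T.leafCenters, ¬ 2 ≤ S.card) : T.split ω = T := by
  induction T with
  | leaf S =>
    rw [split, if_neg]
    rintro ⟨h1, h2⟩
    refine hT S (by simp [leafCenters]) ?_
    have h := S.card_filter_add_card_filter_not (fun c : L1Space d => c ω.1 ≤ ω.2)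
    simp only [not_le] at h
    have := Finset.card_pos.2 h1
    have := Finset.card_pos.2 h2
    omega
  | node j θ l r ihl ihr =>
    simp only [leafCenters, List.mem_append] at hT
    rw [split, ihl fun S hS => hT S (Or.inl hS), ihr fun S hS => hT S (Or.inr hS)]

theorem exists_subset_of_mem_leafCenters_split {T : ThresholdTree d} (ω : Fin d × ℝ)
    {S : Finset (L1Space d)} (hS : S ∈ (T.split ω).leafCenters) :
    (∃ S' ∈ T.leafCenters, S ⊆ S') ∧
      ∀ c ∈ S, ∀ c' ∈ S, c ω.1 ≤ ω.2 → c' ω.1 ≤ ω.2 := by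
  induction T with
  | leaf S' =>
    rw [split] at hS
    split_ifs at hS with h
    · simp only [leafCenters, List.mem_append, List.mem_singleton] at hS
      rcases hS with rfl | rfl
      · exact ⟨⟨S', by simp [leafCenters], Finset.filter_subset _ _⟩,
          fun c _ c' hc' _ => (Finset.mem_filter.1 hc').2⟩
      · exact ⟨⟨S', by simp [leafCenters], Finset.filter_subset _ _⟩,
          fun c hc c' _ h => absurd h (not_le.2 (Finset.mem_filter.1 hc).2)⟩
    · simp only [leafCenters, List.mem_singleton] at hS
      subst hS
      refine ⟨⟨S, by simp [leafCenters], Finset.Subset.refl _⟩, fun c hc c' hc' hle => ?_⟩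
      by_contra hlt
      exact h ⟨⟨c, Finset.mem_filter.2 ⟨hc, hle⟩⟩, ⟨c', Finset.mem_filter.2 ⟨hc', not_le.1 hlt⟩⟩⟩
  | node j θ l r ihl ihr =>
    simp only [split, leafCenters, List.mem_append] at hS ⊢
    rcases hS with hS | hS
    · obtain ⟨⟨S', h, h'⟩, h2⟩ := ihl hS
      exact ⟨⟨S', Or.inl h, h'⟩, h2⟩
    · obtain ⟨⟨S', h, h'⟩, h2⟩ := ihr hS
      exact ⟨⟨S', Or.inr h, h'⟩, h2⟩

theorem locate_mem_leafCenters (T : ThresholdTree d) (x : L1Space d) :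
    T.locate x ∈ T.leafCenters := by
  induction T with
  | leaf S => simp [locate, leafCenters]
  | node j θ l r ihl ihr =>
    simp only [locate, leafCenters, List.mem_append]
    split_ifs
    · exact Or.inl ihl
    · exact Or.inr ihr

end ThresholdTree

section MedianCost

variable {d : ℕ}

theorem medianCost_nonneg (P : Multiset (L1Space d)) : 0 ≤ medianCost P :=
  Real.iInf_nonneg fun _ => Multiset.sum_nonneg fun _ hy => by
    obtain ⟨x, -, rfl⟩ := Multiset.mem_map.1 hy
    exact norm_nonneg _

theorem medianCost_le (P : Multiset (L1Space d)) (c : L1Space d) :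
    medianCost P ≤ (P.map fun x => ‖x - c‖).sum :=
  ciInf_le ⟨0, by
    rintro _ ⟨c, rfl⟩
    refine Multiset.sum_nonneg fun _ hy => ?_
    obtain ⟨x, -, rfl⟩ := Multiset.mem_map.1 hy
    exact norm_nonneg _⟩ c

namespace ThresholdTree

theorem cost_node (j : Fin d) (θ : ℝ) (l r : ThresholdTree d) (X : Multiset (L1Space d)) :
    (node j θ l r).cost X =
      l.cost (X.filter fun x => x j ≤ θ) + r.cost (X.filter fun x => θ < x j) := by
  simp [cost, clusters]

theorem cost_nonneg (T : ThresholdTree d) (X : Multiset (L1Space d)) : 0 ≤ T.cost X :=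
  List.sum_nonneg fun _ hy => by
    obtain ⟨P, -, rfl⟩ := List.mem_map.1 hy
    exact medianCost_nonneg P

theorem sum_map_filter_le_add_lt (f : L1Space d → ℝ) (j : Fin d) (θ : ℝ)
    (X : Multiset (L1Space d)) :
    ((X.filter fun x => x j ≤ θ).map f).sum + ((X.filter fun x => θ < x j).map f).sum =
      (X.map f).sum := by
  have h := Multiset.filter_add_not (fun x : L1Space d => x j ≤ θ) X
  simp only [not_le] at h
  rw [← Multiset.sum_add, ← Multiset.map_add, h]

theorem cost_le_sum_norm (T : ThresholdTree d) (X : Multiset (L1Space d)) :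
    T.cost X ≤ (X.map fun x => ‖x‖).sum := by
  induction T generalizing X with
  | leaf S => simpa [cost, clusters] using medianCost_le X 0
  | node j θ l r ihl ihr =>
    rw [cost_node, ← sum_map_filter_le_add_lt _ j θ X]
    exact add_le_add (ihl _) (ihr _)

/-- If each leaf holds a single center, then the cost is at most the total distance of the points
to the centers of their leaves. -/
theorem cost_le_sum_minVal (T : ThresholdTree d) (hT : ∀ S ∈ T.leafCenters, S.card = 1)
    (X : Multiset (L1Space d)) :
    T.cost X ≤ (X.map fun x => minVal (fun c => ‖x - c‖) (T.locate x)).sum := by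
  induction T generalizing X with
  | leaf S =>
    obtain ⟨c, rfl⟩ := Finset.card_eq_one.1 (hT S (by simp [leafCenters]))
    simpa [cost, clusters, locate, minVal_singleton] using medianCost_le X c
  | node j θ l r ihl ihr =>
    simp only [leafCenters, List.mem_append] at hT
    rw [cost_node, ← sum_map_filter_le_add_lt _ j θ X]
    refine add_le_add ((ihl (fun S hS => hT S (Or.inl hS)) _).trans (le_of_eq ?_))
      ((ihr (fun S hS => hT S (Or.inr hS)) _).trans (le_of_eq ?_))
    · congr 1
      refine Multiset.map_congr rfl fun x hx => ?_
      rw [locate, if_pos (Multiset.mem_filter.1 hx).2]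
    · congr 1
      refine Multiset.map_congr rfl fun x hx => ?_
      rw [locate, if_neg (not_le.2 (Multiset.mem_filter.1 hx).2)]

end ThresholdTree

end MedianCost

section Hits

variable {d : ℕ}

/-- The centers in `C` that the cut `ω` separates from `x`. -/
noncomputable def hits (C : Finset (L1Space d)) (x : L1Space d) (ω : Fin d × ℝ) :
    Finset (L1Space d) :=
  C.filter fun c => ¬ (x ω.1 ≤ ω.2 ↔ c ω.1 ≤ ω.2)

/-- From the point of view of `x`, a round of the algorithm is a round of the elimination game. -/
theorem ThresholdTree.locate_split [DecidableEq (L1Space d)] {C : Finset (L1Space d)}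
    (T : ThresholdTree d) (hT : ∀ S ∈ T.leafCenters, S ⊆ C) (ω : Fin d × ℝ) (x : L1Space d) :
    (T.split ω).locate x = survivors (hits C x ω) (T.locate x) := by
  induction T with
  | leaf S =>
    have hSC := hT S (by simp [leafCenters])
    have e : S \ hits C x ω =
        if x ω.1 ≤ ω.2 then S.filter fun c => c ω.1 ≤ ω.2 else S.filter fun c => ω.2 < c ω.1 := by
      ext c
      have := @hSC c
      split_ifs with hx <;>
        simp only [hits, Finset.mem_sdiff, Finset.mem_filter, hx, ← not_le] <;> tauto
    rw [split]
    by_cases hL : (S.filter fun c => c ω.1 ≤ ω.2).Nonempty <;>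
      by_cases hR : (S.filter fun c => ω.2 < c ω.1).Nonempty <;>
      by_cases hx : x ω.1 ≤ ω.2 <;>
      simp only [hL, hR, hx, locate, survivors, e, and_self, and_true, and_false, if_true, if_false]
    · rw [Finset.not_nonempty_iff_eq_empty, Finset.filter_eq_empty_iff] at hR
      exact (Finset.filter_true_of_mem fun c hc => not_lt.1 (hR hc)).symm
    · rw [Finset.not_nonempty_iff_eq_empty, Finset.filter_eq_empty_iff] at hL
      exact (Finset.filter_true_of_mem fun c hc => not_le.1 (hL hc)).symm
  | node j θ l r ihl ihr =>
    simp only [leafCenters, List.mem_append] at hT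
    rw [split, locate, locate, ihl fun S hS => hT S (Or.inl hS),
      ihr fun S hS => hT S (Or.inr hS)]
    split_ifs <;> rfl

end Hits

/-! ### Dependence on finitely many comparisons -/

section CutType

variable {d : ℕ}

/-- The sides of the cut `ω` on which the points of `Y` lie. This takes finitely many values. -/
def cutType (Y : Finset (L1Space d)) (ω : Fin d × ℝ) : Y → Prop :=
  fun y => y.1 ω.1 ≤ ω.2

theorem measurableSet_le_threshold (y : L1Space d) :
    MeasurableSet {ω : Fin d × ℝ | y ω.1 ≤ ω.2} :=
  measurableSet_le ((measurable_of_countable fun j : Fin d => y j).comp measurable_fst)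
    measurable_snd

theorem measurable_cutType (Y : Finset (L1Space d)) : Measurable (cutType Y) :=
  measurable_pi_iff.2 fun y => measurableSet_setOfPred.1 (measurableSet_le_threshold y.1)

theorem cutType_eq_iff {Y : Finset (L1Space d)} {ω ω' : Fin d × ℝ} :
    cutType Y ω = cutType Y ω' ↔ ∀ y ∈ Y, (y ω.1 ≤ ω.2 ↔ y ω'.1 ≤ ω'.2) := by
  simp [funext_iff, cutType]

/-- Two trees that have the same shape, and whose cuts divide the points of `Y` in the same way,
with the same centers, all of them in `Y`, at the leaves. -/
def ThresholdTree.Similar (Y : Finset (L1Space d)) : ThresholdTree d → ThresholdTree d → Prop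
  | leaf S, leaf S' => S = S' ∧ S ⊆ Y
  | node j θ l r, node j' θ' l' r' =>
      cutType Y (j, θ) = cutType Y (j', θ') ∧ l.Similar Y l' ∧ r.Similar Y r'
  | leaf _, node _ _ _ _ => False
  | node _ _ _ _, leaf _ => False

namespace ThresholdTree

theorem Similar.split {Y : Finset (L1Space d)} {T T' : ThresholdTree d} (h : T.Similar Y T')
    {ω ω' : Fin d × ℝ} (hω : cutType Y ω = cutType Y ω') :
    (T.split ω).Similar Y (T'.split ω') := by
  induction T generalizing T' with
  | leaf S =>
    cases T' with
    | leaf S' =>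
      obtain ⟨rfl, hS⟩ := h
      have hω' := cutType_eq_iff.1 hω
      have e1 : (S.filter fun c => c ω.1 ≤ ω.2) = S.filter fun c => c ω'.1 ≤ ω'.2 :=
        Finset.filter_congr fun c hc => hω' c (hS hc)
      have e2 : (S.filter fun c => ω.2 < c ω.1) = S.filter fun c => ω'.2 < c ω'.1 :=
        Finset.filter_congr fun c hc => by rw [← not_le, ← not_le, hω' c (hS hc)]
      rw [ThresholdTree.split, ThresholdTree.split, e1, e2]
      split_ifs
      · exact ⟨hω, ⟨rfl, (Finset.filter_subset _ _).trans hS⟩,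
          ⟨rfl, (Finset.filter_subset _ _).trans hS⟩⟩
      · exact ⟨rfl, hS⟩
    | node j' θ' l' r' => exact h.elim
  | node j θ l r ihl ihr =>
    cases T' with
    | leaf S' => exact h.elim
    | node j' θ' l' r' => exact ⟨h.1, ihl h.2.1, ihr h.2.2⟩

theorem Similar.locate_eq {Y : Finset (L1Space d)} {T T' : ThresholdTree d} (h : T.Similar Y T')
    {x : L1Space d} (hx : x ∈ Y) : T.locate x = T'.locate x := by
  induction T generalizing T' with
  | leaf S =>
    cases T' with
    | leaf S' => exact h.1
    | node j' θ' l' r' => exact h.elim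
  | node j θ l r ihl ihr =>
    cases T' with
    | leaf S' => exact h.elim
    | node j' θ' l' r' =>
      have := cutType_eq_iff.1 h.1 x hx
      simp only [locate, ihl h.2.1, ihr h.2.2]
      exact if_congr this rfl rfl

theorem Similar.cost_eq {Y : Finset (L1Space d)} {T T' : ThresholdTree d} (h : T.Similar Y T')
    {X : Multiset (L1Space d)} (hX : ∀ x ∈ X, x ∈ Y) : T.cost X = T'.cost X := by
  induction T generalizing T' X with
  | leaf S =>
    cases T' with
    | leaf S' => rfl
    | node j' θ' l' r' => exact h.elim
  | node j θ l r ihl ihr =>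
    cases T' with
    | leaf S' => exact h.elim
    | node j' θ' l' r' =>
      have h1 := cutType_eq_iff.1 h.1
      have e1 : (X.filter fun x => x j ≤ θ) = X.filter fun x => x j' ≤ θ' :=
        Multiset.filter_congr fun x hx => h1 x (hX x hx)
      have e2 : (X.filter fun x => θ < x j) = X.filter fun x => θ' < x j' :=
        Multiset.filter_congr fun x hx => by
          rw [← not_le, ← not_le]
          exact not_congr (h1 x (hX x hx))
      rw [cost_node, cost_node, e1, e2,
        ihl h.2.1 fun x hx => hX x (Multiset.mem_filter.1 hx).1,
        ihr h.2.2 fun x hx => hX x (Multiset.mem_filter.1 hx).1]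

end ThresholdTree

namespace RandomCoordinateCut

theorem treeAfter_similar {C Y : Finset (L1Space d)} (hCY : C ⊆ Y) {n : ℕ}
    {ω ω' : ℕ → Fin d × ℝ} (h : ∀ i < n, cutType Y (ω i) = cutType Y (ω' i)) :
    (treeAfter C ω n).Similar Y (treeAfter C ω' n) := by
  induction n with
  | zero => exact ⟨rfl, hCY⟩
  | succ n ih => exact (ih fun i hi => h i (hi.trans n.lt_succ_self)).split (h n n.lt_succ_self)

/-- A function of the cuts that depends only on the types of the cuts of the first `n` rounds
factors through a measurable function of these types. -/
theorem exists_measurable_factor {Y : Finset (L1Space d)} {n : ℕ} {f : (ℕ → Fin d × ℝ) → ℝ}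
    (hf : ∀ ω ω' : ℕ → Fin d × ℝ, (∀ i < n, cutType Y (ω i) = cutType Y (ω' i)) → f ω = f ω') :
    ∃ g : (Finset.range n → Fin d × ℝ) → ℝ, Measurable g ∧ f = fun ω => g fun i => ω i := by
  classical
  set t : (ℕ → Fin d × ℝ) → Finset.range n → Y → Prop := fun ω i => cutType Y (ω i) with ht
  have hfac : Function.FactorsThrough f t := fun ω ω' h =>
    hf ω ω' fun i hi => congrFun h ⟨i, Finset.mem_range.2 hi⟩
  refine ⟨fun v => Function.extend t f 0 fun i => cutType Y (v i), ?_, ?_⟩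
  · have hext : Measurable (Function.extend t f 0) := Measurable.of_discrete
    exact hext.comp
      (measurable_pi_iff.2 fun i => (measurable_cutType Y).comp (measurable_pi_apply i))
  · funext ω
    exact (hfac.extend_apply 0 ω).symm

theorem measurable_of_cutType {Y : Finset (L1Space d)} {n : ℕ} {f : (ℕ → Fin d × ℝ) → ℝ}
    (hf : ∀ ω ω' : ℕ → Fin d × ℝ, (∀ i < n, cutType Y (ω i) = cutType Y (ω' i)) → f ω = f ω') :
    Measurable f := by
  obtain ⟨g, hg, rfl⟩ := exists_measurable_factor hf
  exact hg.comp (measurable_pi_iff.2 fun i => measurable_pi_apply _)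

end RandomCoordinateCut

end CutType

/-! ### The law of a single cut -/

section SingleCut

variable {d : ℕ}

/-- The set of cuts that separate `x` from `c`. -/
def separatingCuts (x c : L1Space d) : Set (Fin d × ℝ) :=
  {ω | ¬ (x ω.1 ≤ ω.2 ↔ c ω.1 ≤ ω.2)}

theorem measurableSet_separatingCuts (x c : L1Space d) : MeasurableSet (separatingCuts x c) :=
  (MeasurableSet.iff (measurableSet_le_threshold x) (measurableSet_le_threshold c)).compl

theorem abs_apply_le_maxAbs {C : Finset (L1Space d)} {c : L1Space d} (hc : c ∈ C) (j : Fin d) :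
    |c j| ≤ RandomCoordinateCut.maxAbs C := by
  have h1 : ‖c j‖₊ ≤ Finset.univ.sup fun j => ‖c j‖₊ :=
    Finset.le_sup (f := fun j => ‖c j‖₊) (Finset.mem_univ j)
  have h2 : (Finset.univ.sup fun j => ‖c j‖₊) ≤ C.sup fun c => Finset.univ.sup fun j => ‖c j‖₊ :=
    Finset.le_sup (f := fun c : L1Space d => Finset.univ.sup fun j => ‖c j‖₊) hc
  exact_mod_cast h1.trans h2

/-- For `|b| ≤ M`, the length of the part of `(-M, M)` that separates `a` from `b` is `|a - b|`
minus the distance of `a` from `[-M, M]`. -/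
theorem thresholdLaw_real_separating {M a b : ℝ} (hM : 0 < M) (hb : |b| ≤ M) :
    2 * M * (RandomCoordinateCut.thresholdLaw M).real {θ | ¬ (a ≤ θ ↔ b ≤ θ)} =
      |a - b| - (max (-M - a) 0 + max (a - M) 0) := by
  obtain ⟨hb1, hb2⟩ := abs_le.1 hb
  have hvol : ∀ {u v : ℝ} {s : Set ℝ}, u ≤ v → Set.Ioo u v ⊆ s → s ⊆ Set.Icc u v →
      volume.real s = v - u := by
    intro u v s huv h1 h2
    have e : volume s = ENNReal.ofReal (v - u) := le_antisymm
      ((measure_mono h2).trans_eq Real.volume_Icc) (Real.volume_Ioo.symm.trans_le (measure_mono h1))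
    rw [measureReal_def, e, ENNReal.toReal_ofReal (by linarith)]
  rw [RandomCoordinateCut.thresholdLaw, if_pos hM, measureReal_def, cond_apply measurableSet_Ioo,
    ENNReal.toReal_mul, ENNReal.toReal_inv, ← measureReal_def, ← measureReal_def,
    Real.volume_real_Ioo_of_le (by linarith)]
  have : volume.real (Set.Ioo (-M) M ∩ {θ | ¬ (a ≤ θ ↔ b ≤ θ)}) =
      |a - b| - (max (-M - a) 0 + max (a - M) 0) := by
    rcases le_total a b with hab | hab
    · rw [hvol (u := max a (-M)) (v := b) (max_le hab hb1)]
      · rw [abs_of_nonpos (by linarith), max_eq_right (by linarith : a - M ≤ 0)]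
        rcases le_total a (-M) with h | h
        · rw [max_eq_right h, max_eq_left (by linarith)]; ring
        · rw [max_eq_left h, max_eq_right (by linarith)]; ring
      · rintro θ ⟨h1, h2⟩
        obtain ⟨h3, h4⟩ := max_lt_iff.1 h1
        exact ⟨⟨h4, by linarith⟩, fun h => absurd (h.1 h3.le) (not_le.2 h2)⟩
      · rintro θ ⟨⟨h1, h2⟩, h3⟩
        have h4 : a ≤ θ := by
          by_contra h
          exact h3 ⟨fun h' => absurd h' h, fun h' => absurd (hab.trans h') h⟩
        have h5 : θ ≤ b := by
          by_contra h
          exact h3 ⟨fun _ => (not_le.1 h).le, fun _ => h4⟩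
        exact ⟨max_le h4 h1.le, h5⟩
    · rw [hvol (u := b) (v := min a M) (le_min hab hb2)]
      · rw [abs_of_nonneg (by linarith), max_eq_right (by linarith : -M - a ≤ 0)]
        rcases le_total a M with h | h
        · rw [min_eq_left h, max_eq_right (by linarith)]; ring
        · rw [min_eq_right h, max_eq_left (by linarith)]; ring
      · rintro θ ⟨h1, h2⟩
        obtain ⟨h3, h4⟩ := lt_min_iff.1 h2
        exact ⟨⟨by linarith, h4⟩, fun h => absurd (h.2 h1.le) (not_le.2 h3)⟩
      · rintro θ ⟨⟨h1, h2⟩, h3⟩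
        have h4 : b ≤ θ := by
          by_contra h
          exact h3 ⟨fun h' => absurd (hab.trans h') h, fun h' => absurd h' h⟩
        have h5 : θ ≤ a := by
          by_contra h
          exact h3 ⟨fun _ => h4, fun _ => (not_le.1 h).le⟩
        exact ⟨h4, le_min h5 h2.le⟩
  rw [this]
  field_simp
  ring

theorem cutLaw_real_eq_sum [NeZero d] (C : Finset (L1Space d)) {s : Set (Fin d × ℝ)}
    (hs : MeasurableSet s) :
    d * (RandomCoordinateCut.cutLaw C).real s =
      ∑ j, (RandomCoordinateCut.thresholdLaw (RandomCoordinateCut.maxAbs C)).real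
        {θ | (j, θ) ∈ s} := by
  have hd : (d : ENNReal) ≠ 0 := by exact_mod_cast NeZero.ne d
  have h1 : ∀ j : Fin d, uniformOn (Set.univ : Set (Fin d)) {j} = (d : ENNReal)⁻¹ := by
    intro j
    rw [uniformOn_univ]
    simp
  have h2 : RandomCoordinateCut.cutLaw C s = (d : ENNReal)⁻¹ *
      ∑ j, RandomCoordinateCut.thresholdLaw (RandomCoordinateCut.maxAbs C) {θ | (j, θ) ∈ s} := by
    rw [RandomCoordinateCut.cutLaw, Measure.prod_apply hs, lintegral_fintype, Finset.mul_sum]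
    refine Finset.sum_congr rfl fun j _ => ?_
    rw [h1, mul_comm]
    rfl
  rw [measureReal_def, h2, ENNReal.toReal_mul, ENNReal.toReal_inv, ENNReal.toReal_natCast,
    ENNReal.toReal_sum fun j _ => measure_ne_top _ _]
  have hd' : (d : ℝ) ≠ 0 := by exact_mod_cast NeZero.ne d
  rw [mul_inv_cancel_left₀ hd']
  rfl

/-- The distance of `x` from a center is an affine function of the probability that a cut separates
them. The constant term is the distance of `x` from the box `[-M, M]^d`. -/
theorem exists_norm_sub_eq_affine [NeZero d] (C : Finset (L1Space d)) (x : L1Space d) :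
    ∃ r l : ℝ, 0 ≤ r ∧ 0 ≤ l ∧ ∀ c ∈ C,
      ‖x - c‖ = r + l * (RandomCoordinateCut.cutLaw C).real (separatingCuts x c) := by
  set M := RandomCoordinateCut.maxAbs C with hM
  have hM0 : 0 ≤ M := NNReal.coe_nonneg _
  rcases hM0.eq_or_lt with h0 | hpos
  · -- If `M = 0`, then `0` is the only center.
    refine ⟨‖x‖, 0, norm_nonneg _, le_rfl, fun c hc => ?_⟩
    have : c = 0 := by
      ext j
      have := abs_apply_le_maxAbs hc j
      rw [← hM, ← h0] at this
      simpa using this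
    simp [this]
  · refine ⟨∑ j, (max (-M - x j) 0 + max (x j - M) 0), 2 * M * d,
      Finset.sum_nonneg fun j _ => add_nonneg (le_max_right _ _) (le_max_right _ _),
      by positivity, fun c hc => ?_⟩
    rw [mul_assoc, cutLaw_real_eq_sum C (measurableSet_separatingCuts x c), Finset.mul_sum,
      ← Finset.sum_add_distrib, PiLp.norm_eq_of_L1]
    refine Finset.sum_congr rfl fun j _ => ?_
    have h := thresholdLaw_real_separating (a := x j) hpos (abs_apply_le_maxAbs hc j)
    rw [show {θ | (j, θ) ∈ separatingCuts x c} = {θ | ¬ (x j ≤ θ ↔ c j ≤ θ)} from rfl, ← hM, h]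
    simp

theorem cutLaw_separatingCuts_pos [NeZero d] {C : Finset (L1Space d)} {c c' : L1Space d}
    (hc : c ∈ C) (hc' : c' ∈ C) (hne : c ≠ c') :
    0 < (RandomCoordinateCut.cutLaw C).real (separatingCuts c c') := by
  obtain ⟨r, l, -, -, h⟩ := exists_norm_sub_eq_affine C c
  have h1 := h c hc
  have h2 := h c' hc'
  have e : separatingCuts c c = ∅ := by simp [separatingCuts]
  rw [e, sub_self, norm_zero, measureReal_empty, mul_zero, add_zero] at h1
  rw [← h1, zero_add] at h2
  refine lt_of_le_of_ne measureReal_nonneg fun h3 => ?_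
  rw [← h3, mul_zero, norm_eq_zero, sub_eq_zero] at h2
  exact hne h2

end SingleCut

/-! ### Termination -/

namespace RandomCoordinateCut

variable {d : ℕ}

theorem distributes_treeAfter (C : Finset (L1Space d)) (ω : ℕ → Fin d × ℝ) (n : ℕ) :
    (treeAfter C ω n).Distributes C := by
  induction n with
  | zero => rfl
  | succ n ih => exact ih.split (ω n)

theorem nonempty_of_mem_treeAfter {C : Finset (L1Space d)} (hC : C.Nonempty)
    (ω : ℕ → Fin d × ℝ) (n : ℕ) : ∀ S ∈ (treeAfter C ω n).leafCenters, S.Nonempty := by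
  induction n with
  | zero => simpa [treeAfter, ThresholdTree.leafCenters] using hC
  | succ n ih => exact ThresholdTree.nonempty_of_mem_leafCenters_split (ω n) ih

theorem subset_of_mem_treeAfter (C : Finset (L1Space d)) (ω : ℕ → Fin d × ℝ) (n : ℕ) :
    ∀ S ∈ (treeAfter C ω n).leafCenters, S ⊆ C := by
  induction n with
  | zero => simp [treeAfter, ThresholdTree.leafCenters]
  | succ n ih =>
    intro S hS
    obtain ⟨⟨S', hS', h⟩, -⟩ := ThresholdTree.exists_subset_of_mem_leafCenters_split (ω n) hS
    exact h.trans (ih S' hS')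

theorem notMem_separatingCuts_of_mem_treeAfter {C : Finset (L1Space d)} {ω : ℕ → Fin d × ℝ}
    {n : ℕ} {S : Finset (L1Space d)} (hS : S ∈ (treeAfter C ω n).leafCenters) {c c' : L1Space d}
    (hc : c ∈ S) (hc' : c' ∈ S) {i : ℕ} (hi : i < n) : ω i ∉ separatingCuts c c' := by
  induction n generalizing S with
  | zero => omega
  | succ n ih =>
    obtain ⟨⟨S', hS', h⟩, h2⟩ := ThresholdTree.exists_subset_of_mem_leafCenters_split (ω n) hS
    rcases Nat.lt_succ_iff_lt_or_eq.1 hi with hi | rfl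
    · exact ih hS' (h hc) (h hc') hi
    · exact not_not.2 ⟨h2 c hc c' hc', h2 c' hc' c hc⟩

theorem treeAfter_eq_of_stops {C : Finset (L1Space d)} {ω : ℕ → Fin d × ℝ} {n m : ℕ}
    (h : Stops C ω n) (hnm : n ≤ m) : treeAfter C ω m = treeAfter C ω n := by
  induction m, hnm using Nat.le_induction with
  | base => rfl
  | succ m _ ih => rw [treeAfter, ih, ThresholdTree.split_eq_self _ h]

theorem exists_treeAfter_eq_output {C : Finset (L1Space d)} {ω : ℕ → Fin d × ℝ}
    (h : ∃ n, Stops C ω n) :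
    ∃ n, Stops C ω n ∧ ∀ m ≥ n, treeAfter C ω m = output C ω := by
  classical
  refine ⟨Nat.find h, Nat.find_spec h, fun m hm => ?_⟩
  rw [output, dif_pos h, treeAfter_eq_of_stops (Nat.find_spec h) hm]

theorem card_eq_one_of_stops {C : Finset (L1Space d)} (hC : C.Nonempty) {ω : ℕ → Fin d × ℝ}
    {n : ℕ} (h : Stops C ω n) : ∀ S ∈ (treeAfter C ω n).leafCenters, S.card = 1 := by
  intro S hS
  have h1 := h S hS
  have h2 := Finset.card_pos.2 (nonempty_of_mem_treeAfter hC ω n S hS)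
  omega

variable [NeZero d]

instance (C : Finset (L1Space d)) : IsProbabilityMeasure (drawLaw C) := by
  unfold drawLaw
  infer_instance

theorem ae_exists_mem_separatingCuts {C : Finset (L1Space d)} {c c' : L1Space d} (hc : c ∈ C)
    (hc' : c' ∈ C) (hne : c ≠ c') : ∀ᵐ ω ∂(drawLaw C), ∃ i, ω i ∈ separatingCuts c c' := by
  set E := (separatingCuts c c')ᶜ with hE
  have hEm : MeasurableSet E := (measurableSet_separatingCuts c c').compl
  have hlt : cutLaw C E < 1 := by
    have hpos := cutLaw_separatingCuts_pos hc hc' hne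
    rw [measureReal_def, ENNReal.toReal_pos_iff] at hpos
    rw [hE, prob_compl_eq_one_sub (measurableSet_separatingCuts c c')]
    exact ENNReal.sub_lt_self ENNReal.one_ne_top one_ne_zero hpos.1.ne'
  rw [ae_iff]
  have hle : ∀ n : ℕ, drawLaw C {ω | ¬ ∃ i, ω i ∈ separatingCuts c c'} ≤ cutLaw C E ^ n := by
    intro n
    calc drawLaw C {ω | ¬ ∃ i, ω i ∈ separatingCuts c c'}
        ≤ drawLaw C (Set.pi (Finset.range n) fun _ => E) :=
          measure_mono fun ω hω i _ hi => hω ⟨i, hi⟩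
      _ = cutLaw C E ^ n := by
          rw [drawLaw, Measure.infinitePi_pi _ fun _ _ => hEm]
          simp
  exact le_antisymm (ge_of_tendsto' (ENNReal.tendsto_pow_atTop_nhds_zero_of_lt_one hlt) hle)
    (zero_le)

theorem ae_exists_stops (C : Finset (L1Space d)) :
    ∀ᵐ ω ∂(drawLaw C), ∃ n, Stops C ω n := by
  have h : ∀ᵐ ω ∂(drawLaw C), ∀ p ∈ C.offDiag, ∃ i, ω i ∈ separatingCuts p.1 p.2 := by
    refine (ae_ball_iff C.offDiag.countable_toSet).2 fun p hp => ?_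
    obtain ⟨h1, h2, h3⟩ := Finset.mem_offDiag.1 (Finset.mem_coe.1 hp)
    exact ae_exists_mem_separatingCuts h1 h2 h3
  filter_upwards [h] with ω hω
  choose! i hi using hω
  refine ⟨C.offDiag.sup i + 1, fun S hS h2 => ?_⟩
  obtain ⟨c, hc, c', hc', hne⟩ := Finset.one_lt_card.1 h2
  have hSC := subset_of_mem_treeAfter C ω _ S hS
  have hp : (c, c') ∈ C.offDiag := Finset.mem_offDiag.2 ⟨hSC hc, hSC hc', hne⟩
  exact notMem_separatingCuts_of_mem_treeAfter hS hc hc'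
    (Nat.lt_succ_of_le (Finset.le_sup hp)) (hi _ hp)

end RandomCoordinateCut

/-! ### The random tree as an elimination game -/

section Game

variable {d : ℕ}

theorem hits_mem_powerset (C : Finset (L1Space d)) (x : L1Space d) (ω : Fin d × ℝ) :
    hits C x ω ∈ C.powerset :=
  Finset.mem_powerset.2 (Finset.filter_subset _ _)

theorem mem_hits {C : Finset (L1Space d)} {x c : L1Space d} (hc : c ∈ C) {ω : Fin d × ℝ} :
    c ∈ hits C x ω ↔ ω ∈ separatingCuts x c := by
  simp [hits, separatingCuts, hc]

theorem measurableSet_hits_eq (C : Finset (L1Space d)) (x : L1Space d) {h : Finset (L1Space d)}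
    (hh : h ∈ C.powerset) : MeasurableSet (hits C x ⁻¹' {h}) := by
  have e : hits C x ⁻¹' {h} = ⋂ c ∈ C, {ω | ω ∈ separatingCuts x c ↔ c ∈ h} := by
    ext ω
    simp only [Set.mem_preimage, Set.mem_singleton_iff, Set.mem_iInter, Set.mem_ofPred_eq]
    constructor
    · rintro rfl c hc
      exact (mem_hits hc).symm
    · intro H
      ext c
      by_cases hc : c ∈ C
      · rw [mem_hits hc, H c hc]
      · exact ⟨fun h' => absurd (Finset.mem_powerset.1 (hits_mem_powerset C x ω) h') hc,
          fun h' => absurd (Finset.mem_powerset.1 hh h') hc⟩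
  rw [e]
  exact Finset.measurableSet_biInter _ fun c _ =>
    MeasurableSet.iff (measurableSet_separatingCuts x c) (MeasurableSet.const _)

namespace RandomCoordinateCut

theorem measurable_locate_treeAfter (C : Finset (L1Space d)) (x : L1Space d)
    (F : Finset (L1Space d) → ℝ) (n : ℕ) :
    Measurable fun ω => F ((treeAfter C ω n).locate x) := by
  classical
  refine measurable_of_cutType (Y := insert x C) (n := n) fun ω ω' h => ?_
  rw [(treeAfter_similar (Finset.subset_insert x C) h).locate_eq (Finset.mem_insert_self x C)]

theorem locate_treeAfter_subset (C : Finset (L1Space d)) (x : L1Space d) (ω : ℕ → Fin d × ℝ)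
    (n : ℕ) : (treeAfter C ω n).locate x ⊆ C :=
  subset_of_mem_treeAfter C ω n _ (ThresholdTree.locate_mem_leafCenters _ x)

theorem abs_locate_treeAfter_le (C : Finset (L1Space d)) (x : L1Space d)
    (F : Finset (L1Space d) → ℝ) (n : ℕ) (ω : ℕ → Fin d × ℝ) :
    |F ((treeAfter C ω n).locate x)| ≤ ∑ S ∈ C.powerset, |F S| :=
  Finset.single_le_sum (f := fun S => |F S|) (fun _ _ => abs_nonneg _)
    (Finset.mem_powerset.2 (locate_treeAfter_subset C x ω n))

end RandomCoordinateCut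

variable [NeZero d]

/-- The probability that a cut separates `x` from exactly the centers in `h`. -/
noncomputable def hitsWeight (C : Finset (L1Space d)) (x : L1Space d) (h : Finset (L1Space d)) :
    ℝ :=
  (RandomCoordinateCut.cutLaw C).real (hits C x ⁻¹' {h})

theorem sum_hitsWeight (C : Finset (L1Space d)) (x : L1Space d) {s : Finset (Finset (L1Space d))}
    (hs : s ⊆ C.powerset) :
    ∑ h ∈ s, hitsWeight C x h = (RandomCoordinateCut.cutLaw C).real (hits C x ⁻¹' s) :=
  sum_measureReal_preimage_singleton s fun _ hh => measurableSet_hits_eq C x (hs hh)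

theorem sum_hitsWeight_powerset (C : Finset (L1Space d)) (x : L1Space d) :
    ∑ h ∈ C.powerset, hitsWeight C x h = 1 := by
  rw [sum_hitsWeight C x (Finset.Subset.refl _),
    show hits C x ⁻¹' (C.powerset : Set (Finset (L1Space d))) = Set.univ from
      Set.eq_univ_of_forall fun ω => hits_mem_powerset C x ω]
  exact probReal_univ

theorem hitProb_eq_separatingCuts [DecidableEq (L1Space d)] {C : Finset (L1Space d)}
    (x : L1Space d) {c : L1Space d} (hc : c ∈ C) :
    hitProb C.powerset (hitsWeight C x) c =
      (RandomCoordinateCut.cutLaw C).real (separatingCuts x c) := by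
  rw [hitProb, sum_hitsWeight C x (Finset.filter_subset _ _)]
  congr 1
  ext ω
  rw [Set.mem_preimage, Finset.mem_coe, Finset.mem_filter, ← mem_hits hc]
  exact and_iff_right (hits_mem_powerset C x ω)

namespace RandomCoordinateCut

theorem integrable_locate_treeAfter (C : Finset (L1Space d)) (x : L1Space d)
    (F : Finset (L1Space d) → ℝ) (n : ℕ) :
    Integrable (fun ω => F ((treeAfter C ω n).locate x)) (drawLaw C) :=
  Integrable.of_bound (measurable_locate_treeAfter C x F n).aestronglyMeasurable
    (∑ S ∈ C.powerset, |F S|) (ae_of_all _ (abs_locate_treeAfter_le C x F n))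

/-- The cut of round `n` is independent of the leaf of `x` after the first `n` rounds. -/
theorem integral_indicator_mul_locate (C : Finset (L1Space d)) (x : L1Space d)
    (F : Finset (L1Space d) → ℝ) (n : ℕ) {s : Set (Fin d × ℝ)} (hs : MeasurableSet s) :
    ∫ ω, s.indicator (fun _ => (1 : ℝ)) (ω n) * F ((treeAfter C ω n).locate x) ∂(drawLaw C) =
      (cutLaw C).real s * ∫ ω, F ((treeAfter C ω n).locate x) ∂(drawLaw C) := by
  classical
  obtain ⟨g, hg, hfac⟩ := exists_measurable_factor (Y := insert x C) (n := n)
    (f := fun ω => F ((treeAfter C ω n).locate x)) fun ω ω' h => by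
      rw [(treeAfter_similar (Finset.subset_insert x C) h).locate_eq (Finset.mem_insert_self x C)]
  have hfac' : ∀ ω, F ((treeAfter C ω n).locate x) = g fun i => ω i := congrFun hfac
  have hind : iIndepFun (fun (i : ℕ) (ω : ℕ → Fin d × ℝ) => ω i) (drawLaw C) :=
    iIndepFun_infinitePi (X := fun _ ω => ω) fun _ => measurable_id
  have h2 : IndepFun (fun ω : ℕ → Fin d × ℝ => ω n)
      (fun (ω : ℕ → Fin d × ℝ) (i : Finset.range n) => ω i) (drawLaw C) := by
    have := hind.indepFun_finset {n} (Finset.range n) (by simp) fun i => measurable_pi_apply i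
    exact this.comp (measurable_pi_apply (⟨n, Finset.mem_singleton_self n⟩ : ({n} : Finset ℕ)))
      measurable_id
  have hm : Measurable (s.indicator fun _ => (1 : ℝ)) := measurable_const.indicator hs
  simp only [hfac']
  rw [h2.integral_fun_comp_mul_comp (measurable_pi_apply n).aemeasurable
    (measurable_pi_iff.2 fun i => measurable_pi_apply _).aemeasurable
    hm.aestronglyMeasurable hg.aestronglyMeasurable]
  congr 1
  have hmp := measurePreserving_eval_infinitePi (fun _ : ℕ => cutLaw C) n
  have := integral_map (μ := drawLaw C) (measurable_pi_apply n).aemeasurable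
    (f := s.indicator fun _ => (1 : ℝ)) hm.aestronglyMeasurable
  rw [← this]
  have e : (drawLaw C).map (fun ω => ω n) = cutLaw C := hmp.map_eq
  rw [e, integral_indicator_const _ hs, smul_eq_mul, mul_one]

/-- The set of centers that share a leaf with `x` evolves as the players of the elimination game. -/
theorem integral_locate_treeAfter [DecidableEq (L1Space d)] (C : Finset (L1Space d))
    (x : L1Space d) (F : Finset (L1Space d) → ℝ) (n : ℕ) :
    ∫ ω, F ((treeAfter C ω n).locate x) ∂(drawLaw C) =
      payoff C.powerset (hitsWeight C x) F n C := by
  induction n generalizing F with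
  | zero => simp [treeAfter, ThresholdTree.locate, payoff]
  | succ n ih =>
    have hsplit : ∀ ω, F ((treeAfter C ω (n + 1)).locate x) = ∑ h ∈ C.powerset,
        (hits C x ⁻¹' {h}).indicator (fun _ => (1 : ℝ)) (ω n) *
          F (survivors h ((treeAfter C ω n).locate x)) := by
      intro ω
      rw [treeAfter, ThresholdTree.locate_split _ (subset_of_mem_treeAfter C ω n),
        Finset.sum_eq_single_of_mem _ (hits_mem_powerset C x (ω n))]
      · simp
      · intro h _ hne
        rw [Set.indicator_of_notMem (by simpa using hne.symm), zero_mul]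
    have hterm : ∀ h ∈ C.powerset,
        ∫ ω, (hits C x ⁻¹' {h}).indicator (fun _ => (1 : ℝ)) (ω n) *
          F (survivors h ((treeAfter C ω n).locate x)) ∂(drawLaw C) =
        ∫ ω, hitsWeight C x h * F (survivors h ((treeAfter C ω n).locate x)) ∂(drawLaw C) := by
      intro h hh
      rw [integral_indicator_mul_locate C x (fun S => F (survivors h S)) n
        (measurableSet_hits_eq C x hh), integral_const_mul]
      rfl
    simp only [hsplit]
    rw [integral_finsetSum, Finset.sum_congr rfl hterm, ← integral_finsetSum,
      ih fun S => ∑ h ∈ C.powerset, hitsWeight C x h * F (survivors h S), payoff_average]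
    · exact fun h _ => (integrable_locate_treeAfter C x (fun S => F (survivors h S)) n).const_mul _
    · intro h hh
      refine (integrable_locate_treeAfter C x (fun S => F (survivors h S)) n).bdd_mul (c := 1)
        ((measurable_const.indicator (measurableSet_hits_eq C x hh)).comp
          (measurable_pi_apply n)).aestronglyMeasurable (ae_of_all _ fun ω => ?_)
      simp only [Set.indicator]
      split_ifs <;> simp

/-- The expected distance of `x` from the nearest center of its leaf is at most `ln k + 2` times the
distance from the nearest center of all, after any number `n` of rounds. -/
theorem integral_minVal_locate_le {C : Finset (L1Space d)} (hC : C.Nonempty) (x : L1Space d)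
    (n : ℕ) :
    ∫ ω, minVal (fun c => ‖x - c‖) ((treeAfter C ω n).locate x) ∂(drawLaw C) ≤
      (Real.log C.card + 2) * C.inf' hC fun c => ‖x - c‖ := by
  classical
  obtain ⟨r, l, hr, hl, h⟩ := exists_norm_sub_eq_affine C x
  obtain ⟨o, ho, e⟩ := Finset.exists_mem_eq_inf' hC fun c => ‖x - c‖
  rw [integral_locate_treeAfter C x (minVal fun c => ‖x - c‖) n, e]
  exact payoff_minVal_le (q := hitsWeight C x) (D := fun c => ‖x - c‖) (fun _ _ => measureReal_nonneg)
    (sum_hitsWeight_powerset C x) hr hl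
    (fun c hc => by rw [hitProb_eq_separatingCuts x hc, h c hc]) ho n

end RandomCoordinateCut

end Game

section MultisetIntegral

theorem integrable_multiset_sum {α β : Type*} [MeasurableSpace α] {μ : Measure α}
    {f : β → α → ℝ} (hf : ∀ x, Integrable (f x) μ) (X : Multiset β) :
    Integrable (fun ω => (X.map fun x => f x ω).sum) μ := by
  induction X using Multiset.induction_on with
  | empty => simp
  | cons x X ih => simpa [Pi.add_def] using (hf x).add ih

theorem integral_multiset_sum {α β : Type*} [MeasurableSpace α] {μ : Measure α}
    {f : β → α → ℝ} (hf : ∀ x, Integrable (f x) μ) (X : Multiset β) :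
    ∫ ω, (X.map fun x => f x ω).sum ∂μ = (X.map fun x => ∫ ω, f x ω ∂μ).sum := by
  induction X using Multiset.induction_on with
  | empty => simp
  | cons x X ih =>
    simp only [Multiset.map_cons, Multiset.sum_cons]
    rw [integral_add (hf x) (integrable_multiset_sum hf X), ih]

end MultisetIntegral

/-! ### The expected cost -/

open RandomCoordinateCut

theorem theorem2 (d k : ℕ) [NeZero d] (C : Finset (L1Space d)) (hC : C.Nonempty)
    (hk : C.card = k) (X : Multiset (L1Space d)) :
    (∀ᵐ ω ∂(RandomCoordinateCut.drawLaw C),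
      (∃ n, RandomCoordinateCut.Stops C ω n) ∧
      (RandomCoordinateCut.output C ω).numLeaves = k ∧
      (∀ S ∈ (RandomCoordinateCut.output C ω).leafCenters, S.card = 1) ∧
      (RandomCoordinateCut.output C ω).clusters C.val =
        (RandomCoordinateCut.output C ω).leafCenters.map Finset.val) ∧
    MeasureTheory.Integrable (fun ω => (RandomCoordinateCut.output C ω).cost X)
      (RandomCoordinateCut.drawLaw C) ∧
    ∫ ω, (RandomCoordinateCut.output C ω).cost X ∂(RandomCoordinateCut.drawLaw C) ≤
      (2 * Real.log k + 2) * (X.map fun x => C.inf' hC fun c => ‖x - c‖).sum := by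
  classical
  have hterm := ae_exists_stops C
  have hlim : ∀ᵐ ω ∂(drawLaw C), ∃ n, Stops C ω n ∧ ∀ m ≥ n, treeAfter C ω m = output C ω :=
    hterm.mono fun ω => exists_treeAfter_eq_output
  have hmeas : ∀ n, Measurable fun ω => (treeAfter C ω n).cost X := fun n =>
    measurable_of_cutType (Y := C ∪ X.toFinset) (n := n) fun ω ω' h =>
      (treeAfter_similar Finset.subset_union_left h).cost_eq fun x hx =>
        Finset.mem_union_right _ (Multiset.mem_toFinset.2 hx)
  have hcostlim : ∀ᵐ ω ∂(drawLaw C), Filter.Tendsto (fun n => (treeAfter C ω n).cost X)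
      Filter.atTop (nhds ((output C ω).cost X)) := by
    filter_upwards [hlim] with ω ⟨n, _, hn⟩
    refine tendsto_const_nhds.congr' ?_
    filter_upwards [Filter.eventually_ge_atTop n] with m hm
    rw [hn m hm]
  have hint : Integrable (fun ω => (output C ω).cost X) (drawLaw C) := by
    refine Integrable.of_bound (aestronglyMeasurable_of_tendsto_ae Filter.atTop
      (fun n => (hmeas n).aestronglyMeasurable) hcostlim) (X.map fun x => ‖x‖).sum
      (ae_of_all _ fun ω => ?_)
    rw [Real.norm_of_nonneg (ThresholdTree.cost_nonneg _ X)]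
    exact ThresholdTree.cost_le_sum_norm _ X
  refine ⟨?_, hint, ?_⟩
  · filter_upwards [hlim] with ω ⟨n, hn, hout⟩
    rw [← hout n le_rfl]
    have h1 := card_eq_one_of_stops hC hn
    exact ⟨⟨n, hn⟩, hk ▸ (distributes_treeAfter C ω n).numLeaves_eq_card h1, h1,
      (distributes_treeAfter C ω n).clusters_val⟩
  · -- `G` bounds the cost of an output tree by the distances to the centers of the leaves; unlike
    -- the cost, its expectation is controlled after every fixed number of rounds.
    set f : L1Space d → Finset (L1Space d) → ℝ := fun x => minVal fun c => ‖x - c‖ with hf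
    set G : ThresholdTree d → ℝ := fun T => (X.map fun x => f x (T.locate x)).sum with hG
    have hGint : ∀ n, Integrable (fun ω => G (treeAfter C ω n)) (drawLaw C) := fun n =>
      integrable_multiset_sum (fun x => integrable_locate_treeAfter C x (f x) n) X
    have hGle : ∀ n, ∫ ω, G (treeAfter C ω n) ∂(drawLaw C) ≤
        (2 * Real.log k + 2) * (X.map fun x => C.inf' hC fun c => ‖x - c‖).sum := by
      intro n
      -- The elimination game gives the sharper factor `ln k + 2`.
      have hlog : 0 ≤ Real.log k := Real.log_natCast_nonneg k
      simp only [hG]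
      rw [integral_multiset_sum (fun x => integrable_locate_treeAfter C x (f x) n),
        ← Multiset.sum_map_mul_left]
      refine Multiset.sum_map_le_sum_map _ _ fun x _ => ?_
      refine (integral_minVal_locate_le hC x n).trans ?_
      rw [hk]
      refine mul_le_mul_of_nonneg_right (by linarith) ?_
      exact Finset.le_inf' hC _ fun c _ => norm_nonneg _
    have hGlim : ∀ᵐ ω ∂(drawLaw C), Filter.Tendsto (fun n => G (treeAfter C ω n))
        Filter.atTop (nhds (G (output C ω))) := by
      filter_upwards [hlim] with ω ⟨n, _, hn⟩
      refine tendsto_const_nhds.congr' ?_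
      filter_upwards [Filter.eventually_ge_atTop n] with m hm
      rw [hn m hm]
    set K : ℝ := (X.map fun x => ∑ S ∈ C.powerset, |f x S|).sum with hK
    have hGbound : ∀ n ω, ‖G (treeAfter C ω n)‖ ≤ K := by
      intro n ω
      rw [Real.norm_eq_abs]
      refine (Multiset.abs_sum_le_sum_abs).trans ?_
      rw [Multiset.map_map]
      exact Multiset.sum_map_le_sum_map _ _ fun x _ => abs_locate_treeAfter_le C x (f x) n ω
    have hGout : Integrable (fun ω => G (output C ω)) (drawLaw C) := by
      refine Integrable.of_bound (aestronglyMeasurable_of_tendsto_ae Filter.atTop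
        (fun n => (hGint n).aestronglyMeasurable) hGlim) K ?_
      filter_upwards [hlim] with ω ⟨n, _, hn⟩
      rw [← hn n le_rfl]
      exact hGbound n ω
    have hcost : ∀ᵐ ω ∂(drawLaw C), (output C ω).cost X ≤ G (output C ω) := by
      filter_upwards [hlim] with ω ⟨n, hs, hn⟩
      rw [← hn n le_rfl]
      exact ThresholdTree.cost_le_sum_minVal _ (card_eq_one_of_stops hC hs) X
    refine (integral_mono_ae hint hGout hcost).trans ?_
    exact le_of_tendsto' (tendsto_integral_of_dominated_convergence (fun _ => K)
      (fun n => (hGint n).aestronglyMeasurable) (integrable_const K)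
      (fun n => ae_of_all _ (hGbound n)) hGlim) hGle
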